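/- A *zero-dimensional system* is a pair $(X,f)$ of a compact metrizable space $X$ with a basis of clopen sets and a continuous surjection $f:X\to X$; it is *minimal* if $X\neq\emptyset$ and every forward orbit is dense. Its *natural extension* is $\hat X_f=\{(x_i)_{i\in\mathbb Z}\in X^{\mathbb Z}: f(x_i)=x_{i+1}\ \forall i\}$ (with the topology induced by the product topology), together with the left shift $\sigma$. **Coverings.** A *graph* is a finite directed graph $G=(V,E)$, $E\subseteq V\times V$, in which each vertex has an incoming and an outgoing edge. A *cover* $\varphi:G\to G'$ is a graph homomorphism that is surjective on edges and satisfies $\varphi(v)=\varphi(v')$ whenever $(u,v),(u,v')\in E$. A *covering* is a sequence of covers $\varphi_n:G_n\to G_{n-1}$ ($n\ge1$), where $G_0$ has one vertex and one edge. For $m>n$ put $\varphi_{m,n}=\varphi_{n+1}\circ\cdots\circ\varphi_m$. The inverse limit system of the covering is the space of all $(x_n)\in\prod_n V(G_n)$ with $\varphi_{n+1}(x_{n+1})=x_n$ for all $n$ (with the product topology, each $V(G_n)$ being discrete), with the map sending $x$ to $y$ if and only if $(x_n,y_n)\in E(G_n)$ for all $n$. A *GM-covering* is a covering such that each $G_n$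 has a vertex $v_{n,0}$ and finitely many distinct circuits $c_{n,i}=(v_{n,0}=v_{n,i,0},v_{n,i,1},\dots,v_{n,i,l(n,i)}=v_{n,0})$, $1\le i\le r_n$, with $r_n\ge1$ and $l(n,i)\ge 1$ (closed walks whose vertices $v_{n,i,j}$, $0\le j<l(n,i)$, are pairwise distinct), such that: 1. the circuits $c_{n,i}$ together contain all edges of $G_n$; 2. if $v_{n,i,j}=v_{n,i',j'}$ with $1\le j\le l(n,i)$ and $1\le j'\le l(n,i')$, then $l(n,i)-j=l(n,i')-j'$ and $v_{n,i,j+k}=v_{n,i',j'+k}$ for $0\le k\le l(n,i)-j$; 3. $\varphi_n(v_{n,0})=v_{n-1,0}$ for all $n\ge1$; 4. $\varphi_n(v_{n,i,1})=v_{n-1,1,1}$ for all $n\ge1$ and all $i$. It is *simple* if for every $n>0$ there is $m>n$ such that, for each $1\le i\le r_m$, the edges of $\varphi_{m,n}(c_{m,i})$ are exactly all edges of $G_n$. Its *rank* is $\liminf_{n\to\infty} r_n\in\{1,2,\dots,\infty\}$. The *topological rank* of a minimal zero-dimensional system $(X,f)$ is the least rank of a simple GM-covering whose inverse limit system is topologically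 conjugate to $(X,f)$. **Bratteli–Vershik systems.** An *ordered Bratteli diagram* consists of nonempty finite vertex sets $V_0,V_1,\dots$ with $\#V_0=1$, nonempty finite edge sets $E_1,E_2,\dots$, surjective source and range maps $s:E_n\to V_{n-1}$ and $r:E_n\to V_n$, and a partial order on the edges in which two edges are comparable if and only if they have the same range. Its *rank* is $\liminf_{n\to\infty}\#V_n\in\{1,2,\dots,\infty\}$. It is *simple* if there are levels $0=n_0<n_1<\cdots$ such that every vertex of $V_{n_k}$ is joined by a path to every vertex of $V_{n_{k+1}}$, for all $k$. It is *properly ordered* if it is simple and has exactly one infinite path (starting at $V_0$) consisting of maximal edges, and exactly one consisting of minimal edges. The *Vershik map* acts on the space of infinite paths $(e_1,e_2,\dots)$ starting at $V_0$ (topologized as a subspace of $\prod_n E_n$): it sends the maximal path to the minimal path; for any other path, with $n$ least such that $e_n$ is not maximal, it replaces $e_n$ by its immediate successor $f_n$ and $(e_1,\dots,e_{n-1})$ by the path of minimal edges from $V_0$ to $s(f_n)$, leaving $e_k$ unchanged for $k>n$. The *topological rank in the Bratteli–Vershik (Downarowicz–Maass) sense* of a system is the least rank of a properly ordered Bratteli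 diagram whose Vershik system is topologically conjugate to it. **Theorem.** Let $(X,f)$ be a minimal zero-dimensional system, $f$ not necessarily a homeomorphism, with topological rank $K$, $1\le K\le\infty$. Then the natural extension $(\hat X_f,\sigma)$ has a topological rank $L$ in the Bratteli–Vershik sense (in particular, it is conjugate to the Vershik system of a properly ordered Bratteli diagram), and $L\le K$. -/

import Mathlib

open Set Filter Topology

namespace TopRank

/-! ### Zero-dimensional systems, minimality, natural extensions -/

/-- A zero-dimensional system: a continuous surjective self-map of a compact metrizable space
whose clopen sets form a basis of the topology. -/
structure IsZeroDimSystem {X : Type*} [TopologicalSpace X] (f : X → X) : Prop where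
  compact : CompactSpace X
  metrizable : TopologicalSpace.MetrizableSpace X
  clopen_basis : TopologicalSpace.IsTopologicalBasis {s : Set X | IsClopen s}
  continuous : Continuous f
  surjective : Function.Surjective f

/-- A self-map of a nonempty space is minimal if every forward orbit is dense. -/
def IsMinimalMap {X : Type*} [TopologicalSpace X] (f : X → X) : Prop :=
  Nonempty X ∧ ∀ x : X, Dense (Set.range fun n : ℕ => f^[n] x)

/-- The space of two-sided orbits of `f`, with the topology induced from the product `X ^ ℤ`. -/
abbrev NaturalExtension {X : Type*} (f : X → X) : Type _ :=
  {x : ℤ → X // ∀ i : ℤ, f (x i) = x (i + 1)}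

/-- The left shift on the natural extension. -/
def naturalShift {X : Type*} (f : X → X) (x : NaturalExtension f) : NaturalExtension f :=
  ⟨fun i => x.1 (i + 1), fun i => x.2 (i + 1)⟩

/-! ### Graph coverings -/

/-- A cover of directed graphs: an edge-surjective graph homomorphism such that the images of any
two out-neighbours of a vertex coincide. -/
structure IsCover {V W : Type} (G : Digraph V) (H : Digraph W) (φ : V → W) : Prop where
  hom : ∀ u v, G.Adj u v → H.Adj (φ u) (φ v)
  edge_surjective : ∀ a b, H.Adj a b → ∃ u v, G.Adj u v ∧ φ u = a ∧ φ v = b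
  directional : ∀ u v v', G.Adj u v → G.Adj u v' → φ v = φ v'

/-- A graph covering: a sequence `G₀ ← G₁ ← G₂ ← ⋯` of covers of finite directed graphs, all of
whose vertices have an incoming and an outgoing edge, where `G₀` has exactly one vertex (hence
exactly one edge, a loop). -/
structure GraphCovering where
  V : ℕ → Type
  finite : ∀ n, Finite (V n)
  G : ∀ n, Digraph (V n)
  exists_in_edge : ∀ n (v : V n), ∃ u, (G n).Adj u v
  exists_out_edge : ∀ n (v : V n), ∃ w, (G n).Adj v w
  singleton : Nat.card (V 0) = 1
  φ : ∀ n, V (n + 1) → V n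
  isCover : ∀ n, IsCover (G (n + 1)) (G n) (φ n)

namespace GraphCovering

variable (𝒢 : GraphCovering)

/-- The finite vertex sets carry the discrete topology. -/
instance instTopologicalSpaceV (n : ℕ) : TopologicalSpace (𝒢.V n) := ⊥

instance instDiscreteTopologyV (n : ℕ) : DiscreteTopology (𝒢.V n) := ⟨rfl⟩

/-- The composed map `φ_{n+k,n} : G_{n+k} → G_n`. -/
def proj (n : ℕ) : (k : ℕ) → 𝒢.V (n + k) → 𝒢.V n
  | 0 => fun v => v
  | k + 1 => fun v => proj n k (𝒢.φ (n + k) v)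

/-- The inverse limit of the vertex sets, as a subspace of the product. -/
abbrev Limit : Type := {x : ∀ n, 𝒢.V n // ∀ n, x n = 𝒢.φ n (x (n + 1))}

/-- The edge relation of the inverse limit. -/
def LimitAdj (x y : 𝒢.Limit) : Prop := ∀ n, (𝒢.G n).Adj (x.1 n) (y.1 n)

/-- `(X, f)` is topologically conjugate to the inverse limit system of the covering, in which
`x` is mapped to `y` if and only if `(x, y)` is an edge. -/
def Represents {X : Type*} [TopologicalSpace X] (f : X → X) : Prop :=
  ∃ h : X ≃ₜ 𝒢.Limit, ∀ x y : X, f x = y ↔ 𝒢.LimitAdj (h x) (h y)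

end GraphCovering

/-- A covering of Gambaudo–Martens type. The circuit `c_{n,i}` is
`(circuit n i 0, circuit n i 1, …, circuit n i (len n i))`; values of `circuit n i` beyond
`len n i` play no role. Circuits are indexed from `0`, so the first one, `c_{n,1}`, has index `0`. -/
structure GMCovering extends GraphCovering where
  /-- The distinguished vertex `v_{n,0}`. -/
  base : ∀ n, V n
  /-- The number `r_n` of circuits at level `n`. -/
  r : ℕ → ℕ
  r_pos : ∀ n, 0 < r n
  len : ∀ n, Fin (r n) → ℕ
  circuit : ∀ n, Fin (r n) → ℕ → V n
  len_pos : ∀ n i, 1 ≤ len n i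
  circuit_zero : ∀ n i, circuit n i 0 = base n
  circuit_len : ∀ n i, circuit n i (len n i) = base n
  circuit_adj : ∀ n i j, j < len n i → (G n).Adj (circuit n i j) (circuit n i (j + 1))
  circuit_injOn : ∀ n i, Set.InjOn (circuit n i) {j | j < len n i}
  /-- The listed circuits are pairwise different. -/
  circuit_distinct : ∀ n i i', len n i = len n i' →
    (∀ j ≤ len n i, circuit n i j = circuit n i' j) → i = i'
  /-- Every edge lies on one of the circuits. -/
  edge_cover : ∀ n u v, (G n).Adj u v →
    ∃ i j, j < len n i ∧ circuit n i j = u ∧ circuit n i (j + 1) = v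
  /-- Circuits that meet away from their start agree from then on, and end simultaneously. -/
  merge : ∀ n i i' j j', 1 ≤ j → j ≤ len n i → 1 ≤ j' → j' ≤ len n i' →
    circuit n i j = circuit n i' j' →
    len n i - j = len n i' - j' ∧
      ∀ k, j + k ≤ len n i → circuit n i (j + k) = circuit n i' (j' + k)
  φ_base : ∀ n, φ n (base (n + 1)) = base n
  φ_circuit_one : ∀ n i, φ n (circuit (n + 1) i 1) = circuit n ⟨0, r_pos n⟩ 1

namespace GMCovering

variable (𝒢 : GMCovering)

/-- For every `n > 0` there is `m = n + k > n` such that the image in `G_n` of every circuit of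
`G_m` traverses exactly all edges of `G_n`. -/
def IsSimple : Prop :=
  ∀ n, 0 < n → ∃ k, 0 < k ∧ ∀ i : Fin (𝒢.r (n + k)), ∀ a b : 𝒢.V n,
    (∃ j, j < 𝒢.len (n + k) i ∧ 𝒢.proj n k (𝒢.circuit (n + k) i j) = a ∧
      𝒢.proj n k (𝒢.circuit (n + k) i (j + 1)) = b) ↔ (𝒢.G n).Adj a b

/-- The rank `liminf r_n`, possibly infinite. -/
noncomputable def rank : ℕ∞ := liminf (fun n => (𝒢.r n : ℕ∞)) atTop

end GMCovering

/-- `(X, f)` has topological rank `K` (through coverings): `K` is the least rank of a simple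
GM-covering whose inverse limit is conjugate to `(X, f)`. -/
def HasCoveringRank {X : Type*} [TopologicalSpace X] (f : X → X) (K : ℕ∞) : Prop :=
  IsLeast {k : ℕ∞ | ∃ 𝒢 : GMCovering,
    𝒢.IsSimple ∧ 𝒢.toGraphCovering.Represents f ∧ 𝒢.rank = k} K

/-! ### Bratteli–Vershik systems -/

/-- An ordered Bratteli diagram. `E n` is the set of edges from level `n` to level `n + 1`. -/
structure OrderedBratteliDiagram where
  V : ℕ → Type
  E : ℕ → Type
  finite_V : ∀ n, Finite (V n)
  finite_E : ∀ n, Finite (E n)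
  nonempty_V : ∀ n, Nonempty (V n)
  nonempty_E : ∀ n, Nonempty (E n)
  singleton : Nat.card (V 0) = 1
  s : ∀ n, E n → V n
  r : ∀ n, E n → V (n + 1)
  s_surjective : ∀ n, Function.Surjective (s n)
  r_surjective : ∀ n, Function.Surjective (r n)
  order : ∀ n, PartialOrder (E n)
  /-- Two edges are comparable if and only if they have the same range. -/
  comparable_iff : ∀ n (e e' : E n), (e ≤ e' ∨ e' ≤ e) ↔ r n e = r n e'

namespace OrderedBratteliDiagram

variable (B : OrderedBratteliDiagram)

instance instPartialOrderE (n : ℕ) : PartialOrder (B.E n) := B.order n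

/-- The finite edge sets carry the discrete topology. -/
instance instTopologicalSpaceE (n : ℕ) : TopologicalSpace (B.E n) := ⊥

instance instDiscreteTopologyE (n : ℕ) : DiscreteTopology (B.E n) := ⟨rfl⟩

/-- The rank `liminf #V_n`, possibly infinite. -/
noncomputable def rank : ℕ∞ := liminf (fun n => (Nat.card (B.V n) : ℕ∞)) atTop

/-- `B.Reach u n v`: there is a path of edges from the vertex `u` at level `m` down to the vertex
`v` at level `n`. -/
inductive Reach {m : ℕ} (u : B.V m) : (n : ℕ) → B.V n → Prop
  | refl : Reach u m u
  | step {n : ℕ} (e : B.E n) : Reach u n (B.s n e) → Reach u (n + 1) (B.r n e)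

/-- After telescoping to levels `0 = t 0 < t 1 < t 2 < ⋯`, every pair of vertices on consecutive
levels is joined by an edge, that is, by a path of the original diagram. -/
def IsSimple : Prop :=
  ∃ t : ℕ → ℕ, t 0 = 0 ∧ StrictMono t ∧
    ∀ k (u : B.V (t k)) (v : B.V (t (k + 1))), B.Reach u (t (k + 1)) v

/-- The space of infinite paths starting at level `0`, as a subspace of the product. -/
abbrev PathSpace : Type := {e : ∀ n, B.E n // ∀ n, B.r n (e n) = B.s (n + 1) (e (n + 1))}

def IsMaxPath (x : B.PathSpace) : Prop := ∀ n, IsMax (x.1 n)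

def IsMinPath (x : B.PathSpace) : Prop := ∀ n, IsMin (x.1 n)

def IsProperlyOrdered : Prop :=
  B.IsSimple ∧ (∃! x : B.PathSpace, B.IsMaxPath x) ∧ ∃! x : B.PathSpace, B.IsMinPath x

/-- `T` is the Vershik map: it sends a maximal path to a minimal path; and if `n` is the least
index at which the edge `x n` is not maximal, then `T x` has the immediate successor of `x n` at
`n`, minimal edges before `n`, and the edges of `x` after `n`. -/
def IsVershikMap (T : B.PathSpace → B.PathSpace) : Prop :=
  ∀ x : B.PathSpace, (B.IsMaxPath x → B.IsMinPath (T x)) ∧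
    ∀ n, (∀ k < n, IsMax (x.1 k)) → ¬ IsMax (x.1 n) →
      (∀ k < n, IsMin ((T x).1 k)) ∧ x.1 n ⋖ (T x).1 n ∧ ∀ k, n < k → (T x).1 k = x.1 k

/-- `(Y, g)` is topologically conjugate to the Bratteli–Vershik system of the diagram. -/
def Represents {Y : Type*} [TopologicalSpace Y] (g : Y → Y) : Prop :=
  ∃ T : B.PathSpace → B.PathSpace, B.IsVershikMap T ∧
    ∃ h : Y ≃ₜ B.PathSpace, ∀ y : Y, h (g y) = T (h y)

end OrderedBratteliDiagram

/-- `(Y, g)` has topological rank `L` in the Bratteli–Vershik sense: `L` is the least rank of a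
properly ordered Bratteli diagram whose Vershik system is conjugate to `(Y, g)`. -/
def HasBratteliVershikRank {Y : Type*} [TopologicalSpace Y] (g : Y → Y) (L : ℕ∞) : Prop :=
  IsLeast {k : ℕ∞ | ∃ B : OrderedBratteliDiagram,
    B.IsProperlyOrdered ∧ B.Represents g ∧ B.rank = k} L

end TopRank

/-! ### Kakutani–Rokhlin towers: cells along an orbit -/

namespace TopRank

/-! Away from the base vertex each vertex of `G_n` has only one outgoing edge, so a two-sided walk
in `G_n` decomposes uniquely into the circuits `c_{n,i}` (`exists_inCircuit`, `InCircuit.unique`).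
Hence the natural extension has, at level `n`, a Kakutani–Rokhlin partition with one tower per
circuit, and the Bratteli diagram read off these partitions has `r_n` vertices at level `n`. A
covering of least rank thus yields a diagram of the same rank.

The difficulty is proper order. Every circuit of level `n + 1` projects to a walk that begins with
the first circuit of level `n`, which makes the minimal path unique; but such walks may end with
different circuits, so there may be several maximal paths. The remedy is to move bases: since the
projected walk is always followed by the first circuit, cutting each block one first circuit later
makes all blocks end, rather than begin, with it (`Orbit.circ_of_top`). Doing so at odd levels only,
and accumulating the shifts (`delay`, `totalDelay`), keeps the partitions nested (`Orbit.refines`).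
Even levels then force a unique common base point and odd levels a unique common top point
(`towerSystem`).

For any such sequence of partitions, sending a point to its sequence of cells is a conjugacy onto
the Vershik system: injective by `eq_of_sameCell`, surjective by compactness (`path_surjective`),
equivariant by `path_shift_of_not_isMax`. Simplicity of the covering gives simplicity of the diagram
(`Orbit.linked`). -/

/-- A refining sequence of Kakutani–Rokhlin partitions of `Y` for the `ℤ`-action `shift`: at level
`n` the point `y` lies in the tower `tower n y` at height `pos n y`. -/
structure TowerSystem (Y : Type*) [TopologicalSpace Y] where
  shift : ℤ → Y → Y
  shift_zero : ∀ y, shift 0 y = y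
  shift_add : ∀ a b y, shift (a + b) y = shift a (shift b y)
  V : ℕ → Type
  finite_V : ∀ n, Finite (V n)
  card_zero : Nat.card (V 0) = 1
  height : ∀ n, V n → ℕ
  height_zero : ∀ v, height 0 v = 1
  tower : ∀ n, Y → V n
  pos : ℕ → Y → ℕ
  pos_lt : ∀ n y, pos n y < height n (tower n y)
  isOpen_cell : ∀ n y₀, IsOpen {y | tower n y = tower n y₀ ∧ pos n y = pos n y₀}
  step : ∀ n y, pos n y + 1 < height n (tower n y) →
    tower n (shift 1 y) = tower n y ∧ pos n (shift 1 y) = pos n y + 1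
  top : ∀ n y, pos n y + 1 = height n (tower n y) → pos n (shift 1 y) = 0
  onto : ∀ n v, ∃ y, tower n y = v ∧ pos n y = 0
  refines : ∀ n y y', tower (n + 1) y = tower (n + 1) y' → pos (n + 1) y = pos (n + 1) y' →
    tower n y = tower n y' ∧ pos n y = pos n y'
  nested : ∀ n y, pos (n + 1) y = 0 → pos n y = 0
  linked : ∀ n, ∃ m, n < m ∧ ∀ u w, ∃ c : ∀ k, V k, c n = u ∧ c m = w ∧
    ∀ k, ∃ y, tower k y = c k ∧ tower (k + 1) y = c (k + 1)
  separating : ∀ y y', (∀ t n, tower n (shift t y) = tower n (shift t y') ∧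
    pos n (shift t y) = pos n (shift t y')) → y = y'
  -- These two conditions make the minimal and maximal paths unique, and carry equality of cells
  -- across simultaneous tower ends, where `step` says nothing.
  base_unique : ∀ y y', (∀ n, pos n y = 0) → (∀ n, pos n y' = 0) → ∀ n, tower n y = tower n y'
  top_unique : ∀ y y', (∀ n, pos n y + 1 = height n (tower n y)) →
    (∀ n, pos n y' + 1 = height n (tower n y')) → ∀ n, tower n y = tower n y'

namespace TowerSystem

variable {Y : Type*} [TopologicalSpace Y] (S : TowerSystem Y)

theorem shift_neg_shift (t : ℤ) (y : Y) : S.shift (-t) (S.shift t y) = y := by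
  rw [← S.shift_add, neg_add_cancel, S.shift_zero]

theorem shift_shift_neg (t : ℤ) (y : Y) : S.shift t (S.shift (-t) y) = y := by
  rw [← S.shift_add, add_neg_cancel, S.shift_zero]

theorem step_of_ne_zero {n : ℕ} {y : Y} (h : S.pos n (S.shift 1 y) ≠ 0) :
    S.tower n (S.shift 1 y) = S.tower n y ∧ S.pos n (S.shift 1 y) = S.pos n y + 1 := by
  apply S.step
  have h1 := S.pos_lt n y
  have h2 := mt (S.top n y) h
  omega

theorem top_of_shift_eq_zero {n : ℕ} {y : Y} (h : S.pos n (S.shift 1 y) = 0) :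
    S.pos n y + 1 = S.height n (S.tower n y) := by
  by_contra h'
  have h1 := S.pos_lt n y
  have := (S.step n y (by omega)).2
  omega

theorem shift_back {n : ℕ} {y : Y} (m : ℕ) (hm : m ≤ S.pos n y) :
    S.tower n (S.shift (-m) y) = S.tower n y ∧ S.pos n (S.shift (-m) y) + m = S.pos n y := by
  induction m with
  | zero => simp [S.shift_zero]
  | succ m ih =>
    obtain ⟨h1, h2⟩ := ih (by omega)
    have e : S.shift (-m) y = S.shift 1 (S.shift (-(m + 1 : ℕ)) y) := by
      rw [← S.shift_add]; congr 1; push_cast; ring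
    rw [e] at h1 h2
    obtain ⟨h3, h4⟩ := S.step_of_ne_zero (n := n) (y := S.shift (-(m + 1 : ℕ)) y) (by omega)
    exact ⟨h3.symm.trans h1, by omega⟩

theorem shift_forward {n : ℕ} {y : Y} (m : ℕ) (hm : S.pos n y + m < S.height n (S.tower n y)) :
    S.tower n (S.shift m y) = S.tower n y ∧ S.pos n (S.shift m y) = S.pos n y + m := by
  induction m with
  | zero => simp [S.shift_zero]
  | succ m ih =>
    obtain ⟨h1, h2⟩ := ih (by omega)
    have e : S.shift (m + 1 : ℕ) y = S.shift 1 (S.shift m y) := by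
      rw [← S.shift_add]; congr 1; push_cast; ring
    rw [e]
    obtain ⟨h3, h4⟩ := S.step n (S.shift m y) (by rw [h1]; omega)
    exact ⟨h3.trans h1, by omega⟩

/-- The start of a tower of level `n + 1` is also the start of a tower of level `n`, so going back
meets the latter no later. -/
theorem pos_le_succ (n : ℕ) (y : Y) : S.pos n y ≤ S.pos (n + 1) y := by
  by_contra! h
  have h1 := (S.shift_back (n := n + 1) (y := y) _ le_rfl).2
  have h2 := (S.shift_back (n := n) (y := y) _ h.le).2
  have h3 := S.nested n _ (by omega : S.pos (n + 1) (S.shift (-(S.pos (n + 1) y : ℕ)) y) = 0)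
  omega

theorem top_of_succ_top {n : ℕ} {y : Y}
    (h : S.pos (n + 1) y + 1 = S.height (n + 1) (S.tower (n + 1) y)) :
    S.pos n y + 1 = S.height n (S.tower n y) :=
  S.top_of_shift_eq_zero (S.nested _ _ (S.top _ _ h))

theorem pos_zero (y : Y) : S.pos 0 y = 0 := by
  have := S.pos_lt 0 y
  rw [S.height_zero] at this
  omega

/-- Two points lie in the same cell of the partition at level `n`. -/
def SameCell (n : ℕ) (y y' : Y) : Prop := S.tower n y = S.tower n y' ∧ S.pos n y = S.pos n y'

theorem SameCell.of_le {S : TowerSystem Y} {m n : ℕ} {y y' : Y} (h : S.SameCell n y y')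
    (hmn : m ≤ n) : S.SameCell m y y' := by
  induction n, hmn using Nat.le_induction with
  | base => exact h
  | succ n _ ih => exact ih (S.refines n y y' h.1 h.2)

/-- Either both points are at the top of every level, and `base_unique` applies to their images, or
they are below the top from some level on. There a step stays within the tower, and the conclusion
descends to lower levels. -/
theorem sameCell_shift {y y' : Y} (h : ∀ n, S.SameCell n y y') (n : ℕ) :
    S.SameCell n (S.shift 1 y) (S.shift 1 y') := by
  by_cases htop : ∀ n, S.pos n y + 1 = S.height n (S.tower n y)
  · have htop' : ∀ n, S.pos n y' + 1 = S.height n (S.tower n y') := fun n => by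
      rw [← (h n).1, ← (h n).2]; exact htop n
    have h0 := fun n => S.top n y (htop n)
    have h0' := fun n => S.top n y' (htop' n)
    exact ⟨S.base_unique _ _ h0 h0' n, (h0 n).trans (h0' n).symm⟩
  · push Not at htop
    obtain ⟨N, hN⟩ := htop
    have hN' : S.pos (max n N) y + 1 ≠ S.height (max n N) (S.tower (max n N) y) := by
      have : ∀ k, N ≤ k → S.pos k y + 1 ≠ S.height k (S.tower k y) := fun k hk => by
        induction k, hk using Nat.le_induction with
        | base => exact hN
        | succ k _ ih => exact mt S.top_of_succ_top ih
      exact this _ (le_max_right _ _)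
    have hlt := S.pos_lt (max n N) y
    obtain ⟨a1, a2⟩ := S.step (max n N) y (by omega)
    obtain ⟨e1, e2⟩ := h (max n N)
    obtain ⟨b1, b2⟩ := S.step (max n N) y' (by rw [← e1, ← e2]; omega)
    exact SameCell.of_le (n := max n N) ⟨by rw [a1, b1, e1], by rw [a2, b2, e2]⟩ (le_max_left _ _)

theorem sameCell_of_shift {y y' : Y} (h : ∀ n, S.SameCell n (S.shift 1 y) (S.shift 1 y')) (n : ℕ) :
    S.SameCell n y y' := by
  by_cases hbase : ∀ n, S.pos n (S.shift 1 y) = 0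
  · have h0 := fun n => S.top_of_shift_eq_zero (hbase n)
    have h0' := fun n => S.top_of_shift_eq_zero ((h n).2.symm.trans (hbase n))
    have e := S.top_unique y y' h0 h0' n
    have h1 := h0 n
    have h2 := h0' n
    rw [e] at h1
    exact ⟨e, by omega⟩
  · push Not at hbase
    obtain ⟨N, hN⟩ := hbase
    have hN' : S.pos (max n N) (S.shift 1 y) ≠ 0 := by
      have := monotone_nat_of_le_succ (f := fun k => S.pos k (S.shift 1 y))
        (fun k => S.pos_le_succ k _) (le_max_right n N)
      simp only at this
      omega
    obtain ⟨e1, e2⟩ := h (max n N)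
    obtain ⟨a1, a2⟩ := S.step_of_ne_zero hN'
    obtain ⟨b1, b2⟩ := S.step_of_ne_zero (e2 ▸ hN')
    exact SameCell.of_le (n := max n N) ⟨by rw [← a1, ← b1, e1], by omega⟩ (le_max_left _ _)

theorem eq_of_sameCell {y y' : Y} (h : ∀ n, S.SameCell n y y') : y = y' := by
  apply S.separating
  intro t
  induction t using Int.induction_on with
  | zero => intro n; rw [S.shift_zero, S.shift_zero]; exact h n
  | succ i ih =>
    intro n
    rw [add_comm, S.shift_add, S.shift_add]
    exact S.sameCell_shift ih n
  | pred i ih =>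
    intro n
    refine S.sameCell_of_shift (fun n => ?_) n
    rw [← S.shift_add, ← S.shift_add]
    have : (1 : ℤ) + (-i - 1) = -i := by ring
    rw [this]
    exact ih n

/-! ### The ordered Bratteli diagram of the towers -/

/-- The edges from level `n` to level `n + 1`: the positions in the towers of level `n + 1` at
which a tower of level `n` starts. -/
abbrev Edge (n : ℕ) : Type :=
  {p : S.V (n + 1) × ℕ // ∃ y, S.tower (n + 1) y = p.1 ∧ S.pos (n + 1) y = p.2 ∧ S.pos n y = 0}

noncomputable def source (n : ℕ) (e : S.Edge n) : S.V n := S.tower n e.2.choose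

/-- The point chosen in `source` is irrelevant, because a cell of level `n + 1` lies in a single
cell of level `n`. -/
theorem source_eq {n : ℕ} {e : S.Edge n} {y : Y} (h1 : S.tower (n + 1) y = e.1.1)
    (h2 : S.pos (n + 1) y = e.1.2) : S.source n e = S.tower n y :=
  have h := e.2.choose_spec
  (S.refines n _ _ (h.1.trans h1.symm) (h.2.1.trans h2.symm)).1

theorem edge_pos_lt {n : ℕ} (e : S.Edge n) : e.1.2 < S.height (n + 1) e.1.1 := by
  obtain ⟨y, h1, h2, -⟩ := e.2
  rw [← h1, ← h2]
  exact S.pos_lt _ _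

/-- The edge from level `n` to level `n + 1` given by the cells of `y`. -/
def edge (n : ℕ) (y : Y) : S.Edge n :=
  ⟨(S.tower (n + 1) y, S.pos (n + 1) y - S.pos n y), S.shift (-(S.pos n y : ℕ)) y, by
    obtain ⟨-, h2⟩ := S.shift_back (n := n) (y := y) _ le_rfl
    obtain ⟨h3, h4⟩ := S.shift_back (n := n + 1) (y := y) _ (S.pos_le_succ n y)
    exact ⟨h3, by simp only; omega, by omega⟩⟩

theorem source_edge (n : ℕ) (y : Y) : S.source n (S.edge n y) = S.tower n y := by
  obtain ⟨h1, h2⟩ := S.shift_back (n := n) (y := y) _ le_rfl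
  obtain ⟨h3, h4⟩ := S.shift_back (n := n + 1) (y := y) _ (S.pos_le_succ n y)
  rw [S.source_eq (y := S.shift (-(S.pos n y : ℕ)) y) h3 (by simp only [edge]; omega), h1]

/-- The ordered Bratteli diagram of a sequence of Kakutani–Rokhlin partitions. -/
noncomputable def diagram [Nonempty Y] : OrderedBratteliDiagram where
  V := S.V
  E := S.Edge
  finite_V := S.finite_V
  finite_E n := by
    have := S.finite_V (n + 1)
    refine Finite.of_injective
      (fun e : S.Edge n => (⟨e.1.1, e.1.2, S.edge_pos_lt e⟩ :
        Σ v : S.V (n + 1), Fin (S.height (n + 1) v))) ?_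
    rintro ⟨⟨v, a⟩, h⟩ ⟨⟨w, b⟩, h'⟩ e
    simp only [Sigma.mk.injEq] at e
    obtain ⟨rfl, e⟩ := e
    simpa using e
  nonempty_V n := ⟨S.tower n (Classical.arbitrary Y)⟩
  nonempty_E n := ⟨S.edge n (Classical.arbitrary Y)⟩
  singleton := S.card_zero
  s := S.source
  r n e := e.1.1
  s_surjective n u := by
    obtain ⟨y, h, -⟩ := S.onto n u
    exact ⟨S.edge n y, (S.source_edge n y).trans h⟩
  r_surjective n w := by
    obtain ⟨y, h, -⟩ := S.onto (n + 1) w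
    exact ⟨S.edge n y, h⟩
  order n :=
    { le := fun e e' => e.1.1 = e'.1.1 ∧ e.1.2 ≤ e'.1.2
      le_refl := fun e => ⟨rfl, le_rfl⟩
      le_trans := fun a b c h h' => ⟨h.1.trans h'.1, h.2.trans h'.2⟩
      le_antisymm := fun a b h h' => Subtype.ext (Prod.ext h.1 (le_antisymm h.2 h'.2)) }
  comparable_iff n e e' := by
    constructor
    · rintro (h | h)
      exacts [h.1, h.1.symm]
    · intro h
      rcases le_total e.1.2 e'.1.2 with h' | h'
      exacts [Or.inl ⟨h, h'⟩, Or.inr ⟨h.symm, h'⟩]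

/-! ### Conjugacy with the Vershik system -/

section Diagram

variable [Nonempty Y]

/-- The path of edges given by the cells of `y`. -/
def path (y : Y) : S.diagram.PathSpace :=
  ⟨fun n => S.edge n y, fun n => (S.source_edge (n + 1) y).symm⟩

theorem diagram_le {n : ℕ} {e e' : S.diagram.E n} :
    e ≤ e' ↔ e.1.1 = e'.1.1 ∧ e.1.2 ≤ e'.1.2 := Iff.rfl

theorem isMin_iff {n : ℕ} {e : S.diagram.E n} : IsMin e ↔ e.1.2 = 0 := by
  constructor
  · intro h
    obtain ⟨y, h1, h2⟩ := S.onto (n + 1) e.1.1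
    have := @h ⟨(e.1.1, 0), y, h1, h2, S.nested n y h2⟩ ⟨rfl, Nat.zero_le _⟩
    exact Nat.le_zero.1 this.2
  · rintro h b ⟨hb1, hb2⟩
    exact ⟨hb1.symm, by omega⟩

/-- No tower of level `n` starts strictly between the start of the current one and the current
position. -/
theorem edge_pos_le_of_le {n : ℕ} {e : S.diagram.E n} {y : Y} (h : e.1.1 = S.tower (n + 1) y)
    (hle : e.1.2 ≤ S.pos (n + 1) y) : e.1.2 ≤ (S.edge n y).1.2 := by
  by_contra! hlt
  obtain ⟨z, h1, h2, h3⟩ := e.2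
  simp only [edge] at hlt
  have := S.pos_le_succ n y
  obtain ⟨a1, a2⟩ := S.shift_back (n := n + 1) (y := y) (S.pos (n + 1) y - e.1.2) (by omega)
  obtain ⟨b1, b2⟩ := S.shift_back (n := n) (y := y) (S.pos (n + 1) y - e.1.2) (by omega)
  have := (S.refines n _ z (a1.trans (h.symm.trans h1.symm)) (by omega)).2
  omega

theorem isMax_edge_of_top {n : ℕ} {y : Y}
    (h : S.pos (n + 1) y + 1 = S.height (n + 1) (S.tower (n + 1) y)) :
    IsMax ((S.path y).1 n) := by
  intro b hb
  have h1 := S.edge_pos_lt b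
  have h2 : S.tower (n + 1) y = b.1.1 := hb.1
  rw [← h2] at h1
  exact ⟨h2.symm, S.edge_pos_le_of_le h2.symm (by omega)⟩

/-- Otherwise the next point starts a new tower of level `n` inside the same tower of level `n + 1`,
which is a larger edge. -/
theorem top_of_isMax_edge {n : ℕ} {y : Y} (hn : S.pos n y + 1 = S.height n (S.tower n y))
    (h : IsMax ((S.path y).1 n)) :
    S.pos (n + 1) y + 1 = S.height (n + 1) (S.tower (n + 1) y) := by
  by_contra h'
  have hlt := S.pos_lt (n + 1) y
  obtain ⟨h1, h2⟩ := S.step (n + 1) y (by omega)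
  have := @h ⟨(S.tower (n + 1) y, S.pos (n + 1) y + 1), S.shift 1 y, h1, h2, S.top n y hn⟩
    ⟨rfl, by simp only [path, edge]; omega⟩
  have := this.2
  simp only [path, edge] at this
  omega

theorem top_of_isMax_path {y : Y} (n : ℕ) (h : ∀ k < n, IsMax ((S.path y).1 k)) :
    S.pos n y + 1 = S.height n (S.tower n y) := by
  induction n with
  | zero => rw [S.height_zero, S.pos_zero]
  | succ n ih => exact S.top_of_isMax_edge (ih fun k hk => h k (by omega)) (h n (by omega))

theorem isMaxPath_path {y : Y} : S.diagram.IsMaxPath (S.path y) ↔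
    ∀ n, S.pos n y + 1 = S.height n (S.tower n y) :=
  ⟨fun h n => S.top_of_isMax_path n fun k _ => h k, fun h n => S.isMax_edge_of_top (h (n + 1))⟩

theorem isMinPath_path {y : Y} : S.diagram.IsMinPath (S.path y) ↔ ∀ n, S.pos n y = 0 := by
  constructor
  · intro h n
    induction n with
    | zero => exact S.pos_zero y
    | succ n ih =>
      have := S.isMin_iff.1 (h n)
      simp only [path, edge] at this
      omega
  · intro h n
    refine S.isMin_iff.2 ?_
    simp only [path, edge]
    have := h (n + 1)
    omega

theorem path_injective : Function.Injective S.path := by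
  intro y y' h
  have he : ∀ n, S.edge n y = S.edge n y' := fun n => congrFun (congrArg Subtype.val h) n
  refine S.eq_of_sameCell fun n => ?_
  have hsub : Subsingleton (S.V 0) := (Nat.card_eq_one_iff_unique.1 S.card_zero).1
  induction n with
  | zero => exact ⟨Subsingleton.elim _ _, (S.pos_zero y).trans (S.pos_zero y').symm⟩
  | succ n ih =>
    have h1 := congrArg (fun e => e.1.1) (he n)
    have h2 := congrArg (fun e => e.1.2) (he n)
    have h3 := S.pos_le_succ n y
    have h4 := S.pos_le_succ n y'
    have h5 := ih.2
    simp only [edge] at h1 h2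
    exact ⟨h1, by omega⟩

theorem continuous_path : Continuous S.path := by
  refine Continuous.subtype_mk (continuous_pi fun n => ?_) _
  refine (IsLocallyConstant.iff_exists_open _).2 (fun y₀ => ?_) |>.continuous
  refine ⟨_, (S.isOpen_cell n y₀).inter (S.isOpen_cell (n + 1) y₀), ⟨⟨rfl, rfl⟩, rfl, rfl⟩, ?_⟩
  rintro y ⟨⟨h1, h2⟩, h3, h4⟩
  apply Subtype.ext
  simp only [edge, h2, h3, h4]

theorem exists_path_eq (p : S.diagram.PathSpace) (N : ℕ) :
    ∃ y, ∀ n < N, (S.path y).1 n = p.1 n := by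
  induction N with
  | zero => exact ⟨Classical.arbitrary Y, by simp⟩
  | succ N ih =>
    obtain ⟨y, hy⟩ := ih
    obtain ⟨z, h1, h2, h3⟩ := (p.1 N).2
    have hz : S.tower N z = S.tower N y := by
      rw [← S.source_eq h1 h2]
      cases N with
      | zero =>
        have hsub : Subsingleton (S.V 0) := (Nat.card_eq_one_iff_unique.1 S.card_zero).1
        exact Subsingleton.elim _ _
      | succ N =>
        have e1 := p.2 N
        rw [← hy N (by omega)] at e1
        exact e1.symm
    have hlt := S.pos_lt N y
    -- `z` starts the copy of the level-`N` tower prescribed by `p.1 N`. Climbing it to the height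
    -- of `y` reaches the cell of `y`, hence keeps all earlier edges.
    obtain ⟨a1, a2⟩ := S.shift_forward (n := N) (y := z) (S.pos N y) (by rw [hz]; omega)
    have hcell : S.SameCell N (S.shift (S.pos N y) z) y := ⟨a1.trans hz, by omega⟩
    refine ⟨S.shift (S.pos N y) z, fun n hn => ?_⟩
    rcases Nat.lt_succ_iff_lt_or_eq.1 hn with hn | rfl
    · rw [← hy n hn]
      obtain ⟨c1, c2⟩ := hcell.of_le (m := n + 1) hn
      obtain ⟨c3, c4⟩ := hcell.of_le (m := n) hn.le
      apply Subtype.ext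
      simp only [path, edge, c1, c2, c4]
    · have hle := S.pos_le_succ n (S.shift (S.pos n y) z)
      obtain ⟨b1, b2⟩ := S.shift_back (n := n + 1) (y := S.shift (S.pos n y) z) (S.pos n y)
        (by omega)
      rw [S.shift_neg_shift] at b1 b2
      apply Subtype.ext
      refine Prod.ext ?_ ?_ <;> simp only [path, edge]
      · rw [← b1, h1]
      · rw [← h2]; omega

theorem path_surjective [CompactSpace Y] : Function.Surjective S.path := by
  intro p
  have key : (⋂ N : ℕ, {y | ∀ n < N, (S.path y).1 n = p.1 n}).Nonempty := by
    have hcl : ∀ N : ℕ, IsClosed {y | ∀ n < N, (S.path y).1 n = p.1 n} := fun N => by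
      simp only [Set.ofPred_forall]
      refine isClosed_iInter fun n => isClosed_iInter fun _ => ?_
      exact isClosed_eq ((continuous_apply n).comp
        (continuous_subtype_val.comp S.continuous_path)) continuous_const
    refine IsCompact.nonempty_iInter_of_sequence_nonempty_isCompact_isClosed _ ?_
      (S.exists_path_eq p) (hcl 0).isCompact hcl
    intro N y hy n hn
    exact hy n (by omega)
  obtain ⟨y, hy⟩ := key
  refine ⟨y, Subtype.ext (funext fun n => ?_)⟩
  exact mem_iInter.1 hy (n + 1) n (by omega)

theorem exists_pos_eq_zero [CompactSpace Y] : ∃ y, ∀ n, S.pos n y = 0 := by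
  have hcont : ∀ n, Continuous (S.pos n) := fun n =>
    ((IsLocallyConstant.iff_exists_open _).2 fun y₀ =>
      ⟨_, S.isOpen_cell n y₀, ⟨rfl, rfl⟩, fun y hy => hy.2⟩).continuous
  have hcl : ∀ n, IsClosed {y | S.pos n y = 0} := fun n =>
    isClosed_eq (hcont n) continuous_const
  have key : (⋂ n : ℕ, {y | S.pos n y = 0}).Nonempty := by
    refine IsCompact.nonempty_iInter_of_sequence_nonempty_isCompact_isClosed _
      (fun n y hy => S.nested n y hy) (fun n => ?_) (hcl 0).isCompact hcl
    obtain ⟨y, -, hy⟩ := S.onto n (S.tower n (Classical.arbitrary Y))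
    exact ⟨y, hy⟩
  obtain ⟨y, hy⟩ := key
  exact ⟨y, fun n => mem_iInter.1 hy n⟩

theorem reach_of_linked {n m : ℕ} (h : n ≤ m) (c : ∀ k, S.V k)
    (hc : ∀ k, ∃ y, S.tower k y = c k ∧ S.tower (k + 1) y = c (k + 1)) :
    S.diagram.Reach (c n) m (c m) := by
  induction m, h using Nat.le_induction with
  | base => exact .refl
  | succ m _ ih =>
    obtain ⟨y, h1, h2⟩ := hc m
    have e1 : S.diagram.s m (S.edge m y) = c m := (S.source_edge m y).trans h1
    have e2 : S.diagram.r m (S.edge m y) = c (m + 1) := h2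
    rw [← e2]
    exact .step _ (e1.symm ▸ ih)

theorem isSimple_diagram : S.diagram.IsSimple := by
  choose next hlt hnext using S.linked
  refine ⟨fun k => Nat.rec 0 (fun _ a => next a) k, rfl,
    strictMono_nat_of_lt_succ fun k => hlt _, fun k u w => ?_⟩
  obtain ⟨c, rfl, rfl, hc⟩ := hnext _ u w
  exact S.reach_of_linked (hlt _).le c hc

theorem isProperlyOrdered_diagram [CompactSpace Y] : S.diagram.IsProperlyOrdered := by
  refine ⟨S.isSimple_diagram, ?_, ?_⟩
  · obtain ⟨y, hy⟩ := S.exists_pos_eq_zero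
    have hz : ∀ n, S.pos n (S.shift (-1) y) + 1 = S.height n (S.tower n (S.shift (-1) y)) :=
      fun n => S.top_of_shift_eq_zero (by rw [S.shift_shift_neg]; exact hy n)
    refine ⟨S.path (S.shift (-1) y), S.isMaxPath_path.2 hz, fun p hp => ?_⟩
    obtain ⟨z, rfl⟩ := S.path_surjective p
    have hz' := S.isMaxPath_path.1 hp
    congr 1
    refine S.eq_of_sameCell fun n => ?_
    have e := S.top_unique _ _ hz' hz n
    have h1 := hz' n
    have h2 := hz n
    rw [e] at h1
    exact ⟨e, by omega⟩
  · obtain ⟨y, hy⟩ := S.exists_pos_eq_zero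
    refine ⟨S.path y, S.isMinPath_path.2 hy, fun p hp => ?_⟩
    obtain ⟨z, rfl⟩ := S.path_surjective p
    have hz := S.isMinPath_path.1 hp
    congr 1
    exact S.eq_of_sameCell fun n => ⟨S.base_unique _ _ hz hy n, (hz n).trans (hy n).symm⟩

theorem isMin_path_of_pos_eq_zero {y : Y} {n k : ℕ} (h : S.pos n y = 0) (hk : k < n) :
    IsMin ((S.path y).1 k) := by
  have hmono := monotone_nat_of_le_succ (f := fun k => S.pos k y) (fun k => S.pos_le_succ k y)
  have h2 : S.pos (k + 1) y ≤ S.pos n y := hmono hk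
  refine S.isMin_iff.2 ?_
  simp only [path, edge]
  omega

/-- Maximality before `n` puts `y` at the top of its tower of level `n`, so the shift starts a new
one; non-maximality at `n` keeps it in the same tower at all higher levels. The new edge is the
immediate successor because no tower of level `n` starts between the two. -/
theorem path_shift_of_not_isMax {y : Y} {n : ℕ} (h : ∀ k < n, IsMax ((S.path y).1 k))
    (hn : ¬ IsMax ((S.path y).1 n)) :
    (∀ k < n, IsMin ((S.path (S.shift 1 y)).1 k)) ∧
      (S.path y).1 n ⋖ (S.path (S.shift 1 y)).1 n ∧
      ∀ k, n < k → (S.path (S.shift 1 y)).1 k = (S.path y).1 k := by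
  have htop := S.top_of_isMax_path n h
  have h0 := S.top n y htop
  have hstep : ∀ k, n < k → S.tower k (S.shift 1 y) = S.tower k y ∧
      S.pos k (S.shift 1 y) = S.pos k y + 1 := by
    intro k hk
    refine S.step k y ?_
    have : S.pos k y + 1 ≠ S.height k (S.tower k y) := by
      induction k, hk using Nat.le_induction with
      | base => exact mt S.isMax_edge_of_top hn
      | succ k _ ih => exact mt S.top_of_succ_top ih
    have := S.pos_lt k y
    omega
  obtain ⟨h1, h2⟩ := hstep (n + 1) (by omega)
  refine ⟨fun k hk => S.isMin_path_of_pos_eq_zero h0 hk, ⟨?_, ?_⟩, fun k hk => ?_⟩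
  · rw [lt_iff_le_not_ge, diagram_le, diagram_le]
    simp only [path, edge, h1, h2, h0]
    have := S.pos_le_succ n y
    exact ⟨⟨trivial, by omega⟩, fun hc => by have := hc.2; omega⟩
  · intro e he1 he2
    rw [lt_iff_le_not_ge, diagram_le, diagram_le] at he1 he2
    have ht : e.1.1 = S.tower (n + 1) y := he1.1.1.symm
    have h3 : ¬ (S.edge n (S.shift 1 y)).1.2 ≤ e.1.2 := fun hc => he2.2 ⟨he2.1.1.symm, hc⟩
    simp only [edge] at h3
    have h4 := S.edge_pos_le_of_le ht (by omega)
    exact he1.2 ⟨ht, h4⟩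
  · apply Subtype.ext
    obtain ⟨a1, a2⟩ := hstep k hk
    obtain ⟨b1, b2⟩ := hstep (k + 1) (by omega)
    simp only [path, edge, b1, b2, a2]
    congr 1
    omega

theorem represents_diagram [CompactSpace Y] : S.diagram.Represents (S.shift 1) := by
  have : T2Space S.diagram.PathSpace := inferInstance
  let e := Equiv.ofBijective S.path ⟨S.path_injective, S.path_surjective⟩
  let h : Y ≃ₜ S.diagram.PathSpace := Continuous.homeoOfEquivCompactToT2 (f := e) S.continuous_path
  have hh : ∀ y, h y = S.path y := fun _ => rfl
  refine ⟨fun x => h (S.shift 1 (h.symm x)), fun x => ?_, h, fun y => by simp⟩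
  obtain ⟨y, rfl⟩ := h.surjective x
  beta_reduce
  rw [h.symm_apply_apply, hh, hh]
  refine ⟨fun hmax => S.isMinPath_path.2 fun n => S.top n y (S.isMaxPath_path.1 hmax n),
    fun n h1 h2 => S.path_shift_of_not_isMax h1 h2⟩

end Diagram

end TowerSystem

end TopRank

/-! ### Decomposition of two-sided walks into circuits -/

namespace TopRank

namespace GMCovering

variable {𝒢 : GMCovering} {n : ℕ}

theorem circuit_eq_base {i : Fin (𝒢.r n)} {j : ℕ} (hj : j < 𝒢.len n i)
    (h : 𝒢.circuit n i j = 𝒢.base n) : j = 0 :=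
  𝒢.circuit_injOn n i hj (𝒢.len_pos n i) (h.trans (𝒢.circuit_zero n i).symm)

/-- By `merge` the circuits coincide from position 1 on and have equal length, and the listed
circuits are distinct. So the first step out of the base vertex determines the circuit. -/
theorem eq_of_circuit_one {i i' : Fin (𝒢.r n)} (h : 𝒢.circuit n i 1 = 𝒢.circuit n i' 1) :
    i = i' := by
  have h1 := 𝒢.len_pos n i
  have h2 := 𝒢.len_pos n i'
  obtain ⟨hlen, hk⟩ := 𝒢.merge n i i' 1 1 le_rfl h1 le_rfl h2 h
  refine 𝒢.circuit_distinct n i i' (by omega) fun j hj => ?_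
  rcases Nat.eq_zero_or_pos j with rfl | hj0
  · rw [𝒢.circuit_zero, 𝒢.circuit_zero]
  · have := hk (j - 1) (by omega)
    rwa [Nat.add_sub_cancel' hj0] at this

/-- Any edge leaving a non-base vertex lies on some circuit, and `merge` makes all circuits through
that vertex continue alike. -/
theorem eq_circuit_succ_of_adj {i : Fin (𝒢.r n)} {j : ℕ} (h0 : 1 ≤ j) (hj : j < 𝒢.len n i)
    {w : 𝒢.V n} (h : (𝒢.G n).Adj (𝒢.circuit n i j) w) : w = 𝒢.circuit n i (j + 1) := by
  obtain ⟨i', j', hj', h1, rfl⟩ := 𝒢.edge_cover n _ _ h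
  have hj0 : 1 ≤ j' := by
    by_contra! hlt
    obtain rfl : j' = 0 := by omega
    have := circuit_eq_base hj (h1.symm.trans (𝒢.circuit_zero n i'))
    omega
  exact (𝒢.merge n i' i j' j hj0 hj'.le h0 hj.le h1).2 1 hj'

theorem subsingleton_V_zero : Subsingleton (𝒢.V 0) :=
  (Nat.card_eq_one_iff_unique.1 𝒢.singleton).1

theorem len_zero (i : Fin (𝒢.r 0)) : 𝒢.len 0 i = 1 := by
  by_contra h
  have h1 := 𝒢.len_pos 0 i
  have : (1 : ℕ) = 0 := circuit_eq_base (i := i) (by omega) (subsingleton_V_zero.elim _ _)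
  omega

theorem subsingleton_circuits_zero : Subsingleton (Fin (𝒢.r 0)) :=
  ⟨fun i i' => 𝒢.circuit_distinct 0 i i' (by rw [len_zero, len_zero])
    fun _ _ => subsingleton_V_zero.elim _ _⟩

/-- The first circuit, with which the image of every circuit of the next level begins. -/
def first (𝒢 : GMCovering) (n : ℕ) : Fin (𝒢.r n) := ⟨0, 𝒢.r_pos n⟩

/-- At time `t` the walk `a` is in position `j` of the circuit `i`. -/
def InCircuit (a : ℤ → 𝒢.V n) (t : ℤ) (i : Fin (𝒢.r n)) (j : ℕ) : Prop :=
  j < 𝒢.len n i ∧ ∀ k : ℕ, k ≤ 𝒢.len n i → a (t - j + k) = 𝒢.circuit n i k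

section Walk

variable {a : ℤ → 𝒢.V n} {t : ℤ} {i i' : Fin (𝒢.r n)} {j j' : ℕ}

theorem InCircuit.start (h : InCircuit a t i j) : a (t - j) = 𝒢.base n := by
  have := h.2 0 (Nat.zero_le _)
  rwa [Nat.cast_zero, add_zero, 𝒢.circuit_zero] at this

theorem InCircuit.finish (h : InCircuit a t i j) : a (t - j + 𝒢.len n i) = 𝒢.base n :=
  (h.2 _ le_rfl).trans (𝒢.circuit_len n i)

/-- Visits to the base vertex occur only at the ends of the current circuit. -/
theorem InCircuit.le_start (h : InCircuit a t i j) {p : ℤ} (hp : a p = 𝒢.base n) (hpt : p ≤ t) :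
    p ≤ t - j := by
  by_contra! hlt
  have hj := h.1
  obtain ⟨k, rfl⟩ : ∃ k : ℕ, p = t - j + k := ⟨(p - (t - j)).toNat, by omega⟩
  rw [h.2 k (by omega)] at hp
  have := circuit_eq_base (by omega) hp
  omega

theorem InCircuit.finish_le (h : InCircuit a t i j) {q : ℤ} (hq : a q = 𝒢.base n) (hqt : t < q) :
    t - j + 𝒢.len n i ≤ q := by
  by_contra! hlt
  have hj := h.1
  obtain ⟨k, rfl⟩ : ∃ k : ℕ, q = t - j + k := ⟨(q - (t - j)).toNat, by omega⟩
  rw [h.2 k (by omega)] at hq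
  have := circuit_eq_base (by omega) hq
  omega

theorem InCircuit.unique (h : InCircuit a t i j) (h' : InCircuit a t i' j') :
    i = i' ∧ j = j' := by
  have h1 := h.le_start h'.start (by omega)
  have h2 := h'.le_start h.start (by omega)
  obtain rfl : j = j' := by omega
  refine ⟨eq_of_circuit_one ?_, rfl⟩
  rw [← h.2 1 (𝒢.len_pos n i), ← h'.2 1 (𝒢.len_pos n i')]

theorem walk_follows (ha : ∀ t, (𝒢.G n).Adj (a t) (a (t + 1))) (h0 : a t = 𝒢.base n)
    (h1 : a (t + 1) = 𝒢.circuit n i 1) (k : ℕ) (hk : k ≤ 𝒢.len n i) :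
    a (t + k) = 𝒢.circuit n i k := by
  induction k with
  | zero => rw [Nat.cast_zero, add_zero, h0, 𝒢.circuit_zero]
  | succ k ih =>
    rcases Nat.eq_zero_or_pos k with rfl | hk0
    · simpa using h1
    · have := ha (t + k)
      rw [ih (by omega)] at this
      rw [Nat.cast_succ, ← add_assoc]
      exact eq_circuit_succ_of_adj hk0 hk this

theorem exists_walk_follows (ha : ∀ t, (𝒢.G n).Adj (a t) (a (t + 1))) (h0 : a t = 𝒢.base n) :
    ∃ i, ∀ k : ℕ, k ≤ 𝒢.len n i → a (t + k) = 𝒢.circuit n i k := by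
  obtain ⟨i, j, hj, h1, h2⟩ := 𝒢.edge_cover n _ _ (ha t)
  obtain rfl := circuit_eq_base hj (h1.trans h0)
  exact ⟨i, walk_follows ha h0 h2.symm⟩

theorem exists_inCircuit (ha : ∀ t, (𝒢.G n).Adj (a t) (a (t + 1))) (t : ℤ) :
    ∃ i j, InCircuit a t i j := by
  have hpast : ∃ p ≤ t, a p = 𝒢.base n := by
    -- With `M` bounding all lengths, the circuit containing the edge at time `t - M` has returned
    -- to the base by time `t`.
    obtain ⟨M, hM⟩ := (Set.finite_range (𝒢.len n)).bddAbove
    obtain ⟨i, j, hj, h1, h2⟩ := 𝒢.edge_cover n _ _ (ha (t - M))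
    have hlen : 𝒢.len n i ≤ M := hM ⟨i, rfl⟩
    have key : ∀ k : ℕ, j + 1 + k ≤ 𝒢.len n i →
        a (t - M + 1 + k) = 𝒢.circuit n i (j + 1 + k) := by
      intro k
      induction k with
      | zero => exact fun _ => by simpa using h2.symm
      | succ k ih =>
        intro hk
        have h3 := ha (t - M + 1 + k)
        rw [ih (by omega)] at h3
        have := eq_circuit_succ_of_adj (by omega) (by omega) h3
        push_cast
        rw [← add_assoc, this]
        rfl
    refine ⟨t - M + 1 + (𝒢.len n i - (j + 1) : ℕ), by omega, ?_⟩
    rw [key _ (by omega), show j + 1 + (𝒢.len n i - (j + 1)) = 𝒢.len n i by omega,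
      𝒢.circuit_len]
  obtain ⟨p, ⟨hpt, hp⟩, hmax⟩ := Int.exists_greatest_of_bdd (P := fun p => p ≤ t ∧ a p = 𝒢.base n)
    ⟨t, fun p hp => hp.1⟩ hpast
  obtain ⟨i, hi⟩ := exists_walk_follows ha hp
  have hlt : t < p + 𝒢.len n i := by
    by_contra! hle
    have h1 := hmax _ ⟨hle, (hi _ le_rfl).trans (𝒢.circuit_len n i)⟩
    have h2 := 𝒢.len_pos n i
    omega
  refine ⟨i, (t - p).toNat, by omega, fun k hk => ?_⟩
  rw [← hi k hk]
  congr 1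
  omega

/-- The current circuit is determined by the walk between two visits to the base vertex. -/
theorem InCircuit.congr {b : ℤ → 𝒢.V n} {p q : ℤ} {d l : ℕ} (h : InCircuit a (p + d) i j)
    (hd : d < l) (hab : ∀ k : ℕ, k ≤ l → a (p + k) = b (q + k)) (hp : a p = 𝒢.base n)
    (hl : a (p + l) = 𝒢.base n) : InCircuit b (q + d) i j := by
  have h1 := h.le_start hp (by omega)
  have h2 := h.finish_le hl (by omega)
  refine ⟨h.1, fun k hk => ?_⟩
  rw [← h.2 k hk]
  have := hab (d - j + k) (by omega)
  rw [show q + d - j + k = q + (d - j + k : ℕ) by omega, ← this]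
  congr 1
  omega

end Walk

/-! ### Circuits along an orbit on consecutive levels -/

/-- A two-sided orbit of the inverse limit system, as a compatible sequence of two-sided walks. -/
structure Orbit (𝒢 : GMCovering) where
  vert : ∀ n, ℤ → 𝒢.V n
  adj : ∀ n t, (𝒢.G n).Adj (vert n t) (vert n (t + 1))
  compat : ∀ n t, 𝒢.φ n (vert (n + 1) t) = vert n t

namespace Orbit

variable (a b : 𝒢.Orbit) (t u : ℤ)

theorem proj_vert (n k : ℕ) : 𝒢.proj n k (a.vert (n + k) t) = a.vert n t := by
  induction k with
  | zero => rfl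
  | succ k ih => exact (congrArg (𝒢.proj n k) (a.compat (n + k) t)).trans ih

/-- The circuit of level `n` in which the orbit is at time `t`. -/
noncomputable def circ (n : ℕ) (a : 𝒢.Orbit) (t : ℤ) : Fin (𝒢.r n) :=
  (exists_inCircuit (a.adj n) t).choose

/-- The position in its circuit of level `n` in which the orbit is at time `t`. -/
noncomputable def pos (n : ℕ) (a : 𝒢.Orbit) (t : ℤ) : ℕ :=
  (exists_inCircuit (a.adj n) t).choose_spec.choose

theorem inCircuit (n : ℕ) : InCircuit (a.vert n) t (circ n a t) (pos n a t) :=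
  (exists_inCircuit (a.adj n) t).choose_spec.choose_spec

variable {a b t u}

theorem eq_of_inCircuit {i : Fin (𝒢.r n)} {j : ℕ} (h : InCircuit (a.vert n) t i j) :
    circ n a t = i ∧ pos n a t = j :=
  (a.inCircuit t n).unique h

theorem step (h : pos n a t + 1 < 𝒢.len n (circ n a t)) :
    circ n a (t + 1) = circ n a t ∧ pos n a (t + 1) = pos n a t + 1 := by
  refine eq_of_inCircuit ⟨h, fun k hk => ?_⟩
  rw [← (a.inCircuit t n).2 k hk]
  congr 1
  push_cast
  ring

theorem pos_eq_zero_iff : pos n a t = 0 ↔ a.vert n t = 𝒢.base n := by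
  constructor
  · intro h
    have := (a.inCircuit t n).start
    rwa [h, Nat.cast_zero, sub_zero] at this
  · intro h
    have := (a.inCircuit t n).le_start h le_rfl
    omega

theorem vert_succ_of_top (h : pos n a t + 1 = 𝒢.len n (circ n a t)) :
    a.vert n (t + 1) = 𝒢.base n := by
  rw [← (a.inCircuit t n).finish]
  congr 1
  omega

theorem vert_eq : a.vert n t = 𝒢.circuit n (circ n a t) (pos n a t) := by
  rw [← (a.inCircuit t n).2 _ (a.inCircuit t n).1.le, sub_add_cancel]

theorem eq_of_vert {i : Fin (𝒢.r n)} (h0 : a.vert n t = 𝒢.base n)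
    (h1 : a.vert n (t + 1) = 𝒢.circuit n i 1) : circ n a t = i ∧ pos n a t = 0 := by
  refine eq_of_inCircuit ⟨𝒢.len_pos n i, fun k hk => ?_⟩
  rw [Nat.cast_zero, sub_zero]
  exact walk_follows (a.adj n) h0 h1 k hk

/-- Conditions 3 and 4 of a GM-covering start the projected walk at the base and into the first
circuit, which it must then complete. -/
theorem vert_add_of_base (h : a.vert (n + 1) t = 𝒢.base (n + 1)) (k : ℕ)
    (hk : k ≤ 𝒢.len n (𝒢.first n)) : a.vert n (t + k) = 𝒢.circuit n (𝒢.first n) k := by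
  refine walk_follows (a.adj n) ?_ ?_ k hk
  · rw [← a.compat, h, 𝒢.φ_base]
  · obtain ⟨i, hi⟩ := exists_walk_follows (a.adj (n + 1)) h
    have := hi 1 (𝒢.len_pos _ i)
    rw [Nat.cast_one] at this
    rw [← a.compat, this, 𝒢.φ_circuit_one, first]

theorem vert_add_of_base' {D : ℕ} (hD : D = 0 ∨ D = 𝒢.len n (𝒢.first n))
    (h : a.vert (n + 1) t = 𝒢.base (n + 1)) : a.vert n (t + D) = 𝒢.base n := by
  rw [vert_add_of_base h D (by omega)]
  rcases hD with rfl | rfl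
  exacts [𝒢.circuit_zero _ _, 𝒢.circuit_len _ _]

theorem circ_of_base (h : a.vert (n + 1) t = 𝒢.base (n + 1)) : circ n a t = 𝒢.first n := by
  have h0 := vert_add_of_base h 0 (Nat.zero_le _)
  have h1 := vert_add_of_base h 1 (𝒢.len_pos _ _)
  rw [Nat.cast_zero, add_zero, 𝒢.circuit_zero] at h0
  exact (eq_of_vert h0 h1).1

theorem circ_of_top (h : pos (n + 1) a t + 1 = 𝒢.len (n + 1) (circ (n + 1) a t)) :
    circ n a (t + 𝒢.len n (𝒢.first n)) = 𝒢.first n := by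
  have hpos := 𝒢.len_pos n (𝒢.first n)
  refine (eq_of_inCircuit (j := 𝒢.len n (𝒢.first n) - 1) ⟨by omega, fun k hk => ?_⟩).1
  rw [← vert_add_of_base (vert_succ_of_top h) k hk]
  congr 1
  omega

/-- The position at level `n + 1` determines the position at level `n`, also after a delay by the
length of the first circuit. -/
theorem refines {D : ℕ} (hD : D = 0 ∨ D = 𝒢.len n (𝒢.first n))
    (h1 : circ (n + 1) a t = circ (n + 1) b u) (h2 : pos (n + 1) a t = pos (n + 1) b u) :
    circ n a (t + D) = circ n b (u + D) ∧ pos n a (t + D) = pos n b (u + D) := by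
  have ha := a.inCircuit t (n + 1)
  have hb := b.inCircuit u (n + 1)
  rw [← h1, ← h2] at hb
  set i := circ (n + 1) a t
  set j := pos (n + 1) a t
  -- The circuit of level `n + 1` determines the projected walk even `D` steps beyond its end, since
  -- the next circuit starts with the first circuit of level `n`.
  have key : ∀ k : ℕ, k ≤ 𝒢.len (n + 1) i + D → a.vert n (t - j + k) = b.vert n (u - j + k) := by
    intro k hk
    rcases le_total k (𝒢.len (n + 1) i) with hk' | hk'
    · rw [← a.compat, ← b.compat, ha.2 k hk', hb.2 k hk']
    · obtain ⟨k, rfl⟩ := Nat.exists_eq_add_of_le hk'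
      rw [Nat.cast_add, ← add_assoc, ← add_assoc, vert_add_of_base ha.finish k (by omega),
        vert_add_of_base hb.finish k (by omega)]
  have hc := a.inCircuit (t + D) n
  rw [show t + D = t - j + D + j by ring] at hc
  have := hc.congr (b := b.vert n) (q := u - j + D) ha.1 (fun k hk => ?_)
    (vert_add_of_base' hD ha.start) ?_
  · rw [show u - j + D + j = u + D by ring, show t - j + D + j = t + D by ring] at this
    obtain ⟨e1, e2⟩ := eq_of_inCircuit this
    exact ⟨e1.symm, e2.symm⟩
  · have := key (D + k) (by omega)
    rwa [Nat.cast_add, ← add_assoc, ← add_assoc] at this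
  · rw [add_right_comm]
    exact vert_add_of_base' hD ha.finish

theorem shift_forward (m : ℕ) (hm : pos n a t + m < 𝒢.len n (circ n a t)) :
    circ n a (t + m) = circ n a t := by
  refine (eq_of_inCircuit (j := pos n a t + m) ⟨hm, fun k hk => ?_⟩).1
  rw [← (a.inCircuit t n).2 k hk]
  congr 1
  push_cast
  ring

theorem shift_back (m : ℕ) (hm : m ≤ pos n a t) :
    circ n a (t - m) = circ n a t := by
  have hlt := (a.inCircuit t n).1
  refine (eq_of_inCircuit (j := pos n a t - m) ⟨by omega, fun k hk => ?_⟩).1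
  rw [← (a.inCircuit t n).2 k hk]
  congr 1
  omega

/-- The delay preserves which circuits of level `n` occur in a given one of level `n + 1`: the first
circuit lost at the beginning of the block reappears just after its end. -/
theorem linked {D : ℕ} (hD : D = 0 ∨ D = 𝒢.len n (𝒢.first n)) (a : 𝒢.Orbit) (t : ℤ) :
    ∃ t', circ (n + 1) a t' = circ (n + 1) a t ∧ circ n a (t' + D) = circ n a t := by
  rcases hD with rfl | hD
  · exact ⟨t, rfl, by simp⟩
  have hlen := 𝒢.len_pos n (𝒢.first n)
  have hw := a.inCircuit t (n + 1)
  by_cases hle : D ≤ pos (n + 1) a t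
  · exact ⟨t - D, shift_back D hle, by rw [sub_add_cancel]⟩
  · have hstart := hw.start
    have hfin := hw.finish
    have hD' : D ≤ 𝒢.len (n + 1) (circ (n + 1) a t) := by
      by_contra! hlt
      have h1 := vert_add_of_base hstart _ (by omega : 𝒢.len (n + 1) (circ (n + 1) a t) ≤ _)
      rw [← a.compat, hfin, 𝒢.φ_base] at h1
      have := circuit_eq_base (by omega) h1.symm
      have := 𝒢.len_pos (n + 1) (circ (n + 1) a t)
      omega
    have hc : circ n a t = 𝒢.first n := by
      refine (eq_of_inCircuit (j := pos (n + 1) a t) ⟨by omega, fun k hk => ?_⟩).1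
      exact vert_add_of_base hstart k hk
    -- `D` steps before the end of the upper circuit, so that the delayed time is the start of the
    -- next one, where the first circuit begins.
    refine ⟨t - pos (n + 1) a t + (𝒢.len (n + 1) (circ (n + 1) a t) - D : ℕ), ?_, ?_⟩
    · rw [shift_forward, shift_back _ le_rfl]
      rw [shift_back _ le_rfl, pos_eq_zero_iff.2 hstart]
      omega
    · rw [hc, show t - pos (n + 1) a t + (𝒢.len (n + 1) (circ (n + 1) a t) - D : ℕ) + D =
        t - pos (n + 1) a t + 𝒢.len (n + 1) (circ (n + 1) a t) by omega]
      exact circ_of_base hfin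

/-- Every circuit of level `m` projects onto all edges, in particular onto the first edge of circuit
`i`, which identifies `i`. -/
theorem exists_traverses (hs : 𝒢.IsSimple) (hn : 0 < n) : ∃ m, n < m ∧
    ∀ (a : 𝒢.Orbit) (t : ℤ) (i : Fin (𝒢.r n)), ∃ t', circ m a t' = circ m a t ∧
      circ n a t' = i ∧ pos n a t' = 0 := by
  obtain ⟨k, hk, h⟩ := hs n hn
  refine ⟨n + k, by omega, fun a t i => ?_⟩
  obtain ⟨j, hj, h1, h2⟩ := (h (circ (n + k) a t) _ _).2 (𝒢.circuit_adj n i 0 (𝒢.len_pos n i))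
  have hw := a.inCircuit t (n + k)
  rw [← hw.2 j hj.le, proj_vert, 𝒢.circuit_zero] at h1
  rw [← hw.2 (j + 1) hj, proj_vert, Nat.cast_succ, ← add_assoc, zero_add] at h2
  refine ⟨_, ?_, eq_of_vert h1 h2⟩
  rw [shift_forward, shift_back _ le_rfl]
  rwa [shift_back _ le_rfl, pos_eq_zero_iff.2 hw.start, zero_add]

theorem exists_circ_eq (hs : 𝒢.IsSimple) (a : 𝒢.Orbit) (i : Fin (𝒢.r n)) :
    ∃ t, circ n a t = i ∧ pos n a t = 0 := by
  rcases Nat.eq_zero_or_pos n with rfl | hn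
  · exact ⟨0, subsingleton_circuits_zero.elim _ _,
      pos_eq_zero_iff.2 (subsingleton_V_zero.elim _ _)⟩
  · obtain ⟨m, -, h⟩ := exists_traverses hs hn
    obtain ⟨t, -, ht⟩ := h a 0 i
    exact ⟨t, ht⟩

theorem exists_circ_eq_and_circ_eq (hs : 𝒢.IsSimple) (a : 𝒢.Orbit) (n : ℕ) : ∃ m, n < m ∧
    ∀ (i : Fin (𝒢.r n)) (i' : Fin (𝒢.r m)), ∃ t, circ n a t = i ∧ circ m a t = i' := by
  rcases Nat.eq_zero_or_pos n with rfl | hn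
  · refine ⟨1, one_pos, fun i i' => ?_⟩
    obtain ⟨t, ht, -⟩ := exists_circ_eq hs a i'
    exact ⟨t, subsingleton_circuits_zero.elim _ _, ht⟩
  · obtain ⟨m, hnm, h⟩ := exists_traverses hs hn
    refine ⟨m, hnm, fun i i' => ?_⟩
    obtain ⟨t, ht, -⟩ := exists_circ_eq hs a i'
    obtain ⟨t', h1, h2, -⟩ := h a t i
    exact ⟨t', h2, h1.trans ht⟩

end Orbit

/-! ### Delayed bases -/

/-- The delay between the bases of the partitions of levels `n` and `n + 1`. -/
def delay (𝒢 : GMCovering) (n : ℕ) : ℕ := if Even n then 0 else 𝒢.len n (𝒢.first n)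

theorem delay_eq (𝒢 : GMCovering) (n : ℕ) :
    𝒢.delay n = 0 ∨ 𝒢.delay n = 𝒢.len n (𝒢.first n) := by
  unfold delay
  split_ifs <;> simp

/-- The time by which the base of the partition of level `n` is delayed. -/
def totalDelay (𝒢 : GMCovering) (n : ℕ) : ℤ := ∑ k ∈ Finset.range n, (𝒢.delay k : ℤ)

theorem sub_totalDelay (𝒢 : GMCovering) (n : ℕ) (t : ℤ) :
    t - 𝒢.totalDelay n = t - 𝒢.totalDelay (n + 1) + 𝒢.delay n := by
  rw [totalDelay, totalDelay, Finset.sum_range_succ]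
  ring

end GMCovering

end TopRank

/-! ### The natural extension and its towers -/

namespace TopRank

section NaturalExtension

variable {X : Type*} {f : X → X}

/-- The `t`-th power of the shift on the natural extension. -/
def shiftBy (t : ℤ) (y : NaturalExtension f) : NaturalExtension f :=
  ⟨fun i => y.1 (i + t), fun i => by rw [y.2, add_right_comm]⟩

theorem shiftBy_zero (y : NaturalExtension f) : shiftBy 0 y = y :=
  Subtype.ext (funext fun i => congrArg y.1 (add_zero i))

theorem shiftBy_add (t u : ℤ) (y : NaturalExtension f) :
    shiftBy (t + u) y = shiftBy t (shiftBy u y) :=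
  Subtype.ext (funext fun i => congrArg y.1 (add_assoc i t u).symm)

theorem nonempty_naturalExtension [hX : Nonempty X] (hf : Function.Surjective f) :
    Nonempty (NaturalExtension f) := by
  obtain ⟨x⟩ := hX
  have hg := Function.rightInverse_surjInv hf
  refine ⟨fun i : ℤ => match i with
    | .ofNat n => f^[n] x
    | .negSucc n => (Function.surjInv hf)^[n + 1] x, fun i => ?_⟩
  match i with
  | .ofNat n => exact (Function.iterate_succ_apply' f n x).symm
  | .negSucc 0 => exact hg x
  | .negSucc (n + 1) =>
    exact (congrArg f (Function.iterate_succ_apply' _ (n + 1) x)).trans (hg _)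

theorem compactSpace_naturalExtension [TopologicalSpace X] [CompactSpace X] [T2Space X]
    (hf : Continuous f) : CompactSpace (NaturalExtension f) := by
  have : IsClosed {x : ℤ → X | ∀ i : ℤ, f (x i) = x (i + 1)} := by
    rw [Set.ofPred_forall]
    exact isClosed_iInter fun i =>
      isClosed_eq (hf.comp (continuous_apply i)) (continuous_apply (i + 1))
  exact isCompact_iff_compactSpace.1 this.isCompact

end NaturalExtension

namespace GMCovering

variable {𝒢 : GMCovering} {X : Type*} [TopologicalSpace X] {f : X → X}
  (h : X ≃ₜ 𝒢.toGraphCovering.Limit) (hh : ∀ x y : X, f x = y ↔ 𝒢.LimitAdj (h x) (h y))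

/-- The two-sided orbit of the inverse limit system given by a point of the natural extension. -/
def orbit (y : NaturalExtension f) : 𝒢.Orbit where
  vert n t := (h (y.1 t)).1 n
  adj n t := (hh _ _).1 (y.2 t) n
  compat n t := ((h (y.1 t)).2 n).symm

theorem circ_orbit_shiftBy (n : ℕ) (t u : ℤ) (y : NaturalExtension f) :
    Orbit.circ n (orbit h hh (shiftBy t y)) u = Orbit.circ n (orbit h hh y) (t + u) ∧
      Orbit.pos n (orbit h hh (shiftBy t y)) u = Orbit.pos n (orbit h hh y) (t + u) := by
  obtain ⟨h1, h2⟩ := (orbit h hh y).inCircuit (t + u) n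
  refine Orbit.eq_of_inCircuit ⟨h1, fun k hk => ?_⟩
  rw [← h2 k hk]
  exact congrArg (fun i => (h (y.1 i)).1 n) (by ring)

theorem isOpen_circ_pos (n : ℕ) (t : ℤ) (y₀ : NaturalExtension f) :
    IsOpen {y | Orbit.circ n (orbit h hh y) t = Orbit.circ n (orbit h hh y₀) t ∧
      Orbit.pos n (orbit h hh y) t = Orbit.pos n (orbit h hh y₀) t} := by
  have hset : {y | Orbit.circ n (orbit h hh y) t = Orbit.circ n (orbit h hh y₀) t ∧
      Orbit.pos n (orbit h hh y) t = Orbit.pos n (orbit h hh y₀) t} =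
      ⋂ k ∈ Set.Iic (𝒢.len n (Orbit.circ n (orbit h hh y₀) t)),
        {y | (h (y.1 (t - Orbit.pos n (orbit h hh y₀) t + k))).1 n =
          𝒢.circuit n (Orbit.circ n (orbit h hh y₀) t) k} := by
    ext y
    rw [mem_iInter₂]
    constructor
    · rintro ⟨h1, h2⟩ k hk
      have := (orbit h hh y).inCircuit t n
      rw [h1, h2] at this
      exact this.2 k hk
    · intro hy
      exact Orbit.eq_of_inCircuit ⟨((orbit h hh y₀).inCircuit t n).1, hy⟩
  rw [hset]
  refine (Set.finite_Iic _).isOpen_biInter fun k _ => ?_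
  have hc : Continuous fun y : NaturalExtension f =>
      (h (y.1 (t - Orbit.pos n (orbit h hh y₀) t + k))).1 n :=
    (continuous_apply n).comp (continuous_subtype_val.comp
      (h.continuous.comp ((continuous_apply _).comp continuous_subtype_val)))
  exact (isOpen_discrete {𝒢.circuit n (Orbit.circ n (orbit h hh y₀) t) k}).preimage hc

/-- The Kakutani–Rokhlin partitions of the natural extension whose towers are the circuits, with
bases delayed at every other level. The delays make both the base point and its predecessor
unique. -/
noncomputable def towerSystem (hs : 𝒢.IsSimple) [Nonempty (NaturalExtension f)] :
    TowerSystem (NaturalExtension f) where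
  shift := shiftBy
  shift_zero := shiftBy_zero
  shift_add := shiftBy_add
  V n := Fin (𝒢.r n)
  finite_V n := inferInstance
  card_zero := by
    have := subsingleton_circuits_zero (𝒢 := 𝒢)
    exact Nat.card_eq_one_iff_unique.2 ⟨this, ⟨𝒢.first 0⟩⟩
  height := 𝒢.len
  height_zero := len_zero
  tower n y := Orbit.circ n (orbit h hh y) (0 - 𝒢.totalDelay n)
  pos n y := Orbit.pos n (orbit h hh y) (0 - 𝒢.totalDelay n)
  pos_lt n y := ((orbit h hh y).inCircuit _ n).1
  isOpen_cell n y₀ := isOpen_circ_pos h hh n _ y₀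
  step n y hy := by
    rw [(circ_orbit_shiftBy h hh n 1 _ y).1, (circ_orbit_shiftBy h hh n 1 _ y).2, add_comm]
    exact Orbit.step hy
  top n y hy := by
    rw [(circ_orbit_shiftBy h hh n 1 _ y).2, add_comm]
    exact Orbit.pos_eq_zero_iff.2 (Orbit.vert_succ_of_top hy)
  onto n v := by
    obtain ⟨t, h1, h2⟩ := Orbit.exists_circ_eq hs
      (orbit h hh (Classical.arbitrary (NaturalExtension f))) v
    refine ⟨shiftBy (t + 𝒢.totalDelay n) (Classical.arbitrary _), ?_⟩
    rw [(circ_orbit_shiftBy h hh n _ _ _).1, (circ_orbit_shiftBy h hh n _ _ _).2,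
      show t + 𝒢.totalDelay n + (0 - 𝒢.totalDelay n) = t by ring]
    exact ⟨h1, h2⟩
  refines n y y' h1 h2 := by
    rw [𝒢.sub_totalDelay n 0]
    exact Orbit.refines (𝒢.delay_eq n) h1 h2
  nested n y hy := by
    rw [𝒢.sub_totalDelay n 0]
    exact Orbit.pos_eq_zero_iff.2
      (Orbit.vert_add_of_base' (𝒢.delay_eq n) (Orbit.pos_eq_zero_iff.1 hy))
  linked n := by
    set y₀ := Classical.arbitrary (NaturalExtension f)
    obtain ⟨m, hnm, hm⟩ := Orbit.exists_circ_eq_and_circ_eq hs (orbit h hh y₀) n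
    refine ⟨m, hnm, fun u w => ?_⟩
    obtain ⟨t, h1, h2⟩ := hm u w
    -- The chain uses the undelayed circuits at one common time; `Orbit.linked` then realizes each
    -- consecutive pair with the delay, possibly at another time.
    refine ⟨fun k => Orbit.circ k (orbit h hh y₀) t, h1, h2, fun k => ?_⟩
    obtain ⟨t', h3, h4⟩ := Orbit.linked (𝒢.delay_eq k) (orbit h hh y₀) t
    refine ⟨shiftBy (t' + 𝒢.totalDelay (k + 1)) y₀, ?_, ?_⟩
    · rw [(circ_orbit_shiftBy h hh k _ _ _).1, 𝒢.sub_totalDelay k 0]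
      refine Eq.trans ?_ h4
      congr 1
      ring
    · rw [(circ_orbit_shiftBy h hh (k + 1) _ _ _).1]
      refine Eq.trans ?_ h3
      congr 1
      ring
  separating y y' hy := by
    refine Subtype.ext (funext fun t => h.injective (Subtype.ext (funext fun n => ?_)))
    obtain ⟨h1, h2⟩ := hy (t + 𝒢.totalDelay n) n
    rw [(circ_orbit_shiftBy h hh n _ _ _).1, (circ_orbit_shiftBy h hh n _ _ _).1] at h1
    rw [(circ_orbit_shiftBy h hh n _ _ _).2, (circ_orbit_shiftBy h hh n _ _ _).2] at h2
    rw [show t + 𝒢.totalDelay n + (0 - 𝒢.totalDelay n) = t by ring] at h1 h2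
    have e1 := Orbit.vert_eq (a := orbit h hh y) (n := n) (t := t)
    have e2 := Orbit.vert_eq (a := orbit h hh y') (n := n) (t := t)
    rw [h1, h2] at e1
    exact e1.trans e2.symm
  base_unique y y' hy hy' n := by
    have key : ∀ n, Even n → ∀ z : NaturalExtension f,
        Orbit.pos (n + 1) (orbit h hh z) (0 - 𝒢.totalDelay (n + 1)) = 0 →
        Orbit.circ n (orbit h hh z) (0 - 𝒢.totalDelay n) = 𝒢.first n := by
      intro n hn z hz
      rw [𝒢.sub_totalDelay n 0, delay, if_pos hn, Nat.cast_zero, add_zero]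
      exact Orbit.circ_of_base (Orbit.pos_eq_zero_iff.1 hz)
    rcases Nat.even_or_odd n with hn | hn
    · rw [key n hn y (hy _), key n hn y' (hy' _)]
    -- At an odd level the tower is found from the next, even level, where both points are at the
    -- bottom of the first tower.
    · have h1 := (key (n + 1) hn.add_one y (hy _)).trans (key (n + 1) hn.add_one y' (hy' _)).symm
      rw [𝒢.sub_totalDelay n 0]
      exact (Orbit.refines (𝒢.delay_eq n) h1 ((hy _).trans (hy' _).symm)).1
  top_unique y y' hy hy' n := by
    have key : ∀ n, Odd n → ∀ z : NaturalExtension f,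
        Orbit.pos (n + 1) (orbit h hh z) (0 - 𝒢.totalDelay (n + 1)) + 1 =
          𝒢.len (n + 1) (Orbit.circ (n + 1) (orbit h hh z) (0 - 𝒢.totalDelay (n + 1))) →
        Orbit.circ n (orbit h hh z) (0 - 𝒢.totalDelay n) = 𝒢.first n := by
      intro n hn z hz
      rw [𝒢.sub_totalDelay n 0, delay, if_neg (Nat.not_even_iff_odd.2 hn)]
      exact Orbit.circ_of_top hz
    rcases Nat.even_or_odd n with hn | hn
    -- Symmetrically, an even level is settled from the next, odd one: equal towers and both points
    -- at the top give equal positions there.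
    · have h1 := (key (n + 1) hn.add_one y (hy _)).trans (key (n + 1) hn.add_one y' (hy' _)).symm
      have h2 := hy (n + 1)
      have h3 := hy' (n + 1)
      rw [h1] at h2
      rw [𝒢.sub_totalDelay n 0]
      exact (Orbit.refines (𝒢.delay_eq n) h1 (by omega)).1
    · rw [key n hn y (hy _), key n hn y' (hy' _)]

end GMCovering

end TopRank

theorem mainTheorem1 {X : Type*} [TopologicalSpace X] (f : X → X)
    (hf : TopRank.IsZeroDimSystem f) (hmin : TopRank.IsMinimalMap f)
    (K : ℕ∞) (hK : 1 ≤ K) (hrank : TopRank.HasCoveringRank f K) :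
    ∃ L : ℕ∞, TopRank.HasBratteliVershikRank (TopRank.naturalShift f) L ∧ L ≤ K := by
  obtain ⟨𝒢, hs, ⟨h, hh⟩, rfl⟩ := hrank.1
  have := hf.compact
  have := hf.metrizable
  have := hmin.1
  have := TopRank.nonempty_naturalExtension hf.surjective
  have := TopRank.compactSpace_naturalExtension hf.continuous
  let S := TopRank.GMCovering.towerSystem h hh hs
  have hmem : 𝒢.rank ∈ {k : ℕ∞ | ∃ B : TopRank.OrderedBratteliDiagram,
      B.IsProperlyOrdered ∧ B.Represents (TopRank.naturalShift f) ∧ B.rank = k} := by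
    refine ⟨S.diagram, S.isProperlyOrdered_diagram, S.represents_diagram, ?_⟩
    have hcard : ∀ n, Nat.card (S.diagram.V n) = 𝒢.r n := fun n => Nat.card_fin _
    simp only [TopRank.OrderedBratteliDiagram.rank, TopRank.GMCovering.rank, hcard]
  -- `ℕ∞` is well-ordered, so one diagram of rank `𝒢.rank` suffices for a least rank to exist and be
  -- at most that.
  exact ⟨_, ⟨csInf_mem ⟨_, hmem⟩, fun _ hk => csInf_le' hk⟩, csInf_le' hmem⟩
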